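/- Let $\gamma$ be the Euler–Mascheroni constant and let $\gamma(n)$, $n\ge 0$, be the Stieltjes constants, i.e. the numbers in the Laurent expansion of the Riemann zeta function about $s=1$, $$\zeta(s)=\frac{1}{s-1}+\sum_{n=0}^{\infty}\frac{(-1)^n}{n!}\,\gamma(n)\,(s-1)^n ,\qquad s\neq 1 .$$ Then the integral below converges absolutely and $$\int_{-\infty}^{\infty}\frac{\zeta\!\left(\frac32-iv\right)\,\zeta\!\left(\frac12+iv\right)}{\cosh^{3}(\pi v)}\,dv=-\frac{17\pi^{2}}{120}+\frac{\gamma^{2}}{2}+\gamma(1)+\frac{\frac{\gamma(3)}{3}+\gamma\,\gamma(2)-\gamma(1)^{2}}{\pi^{2}} .$$ -/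

import Mathlib

/-- The regular part of `ζ` at `s = 1`, i.e. `ζ(s) - 1/(s-1)` for `s ≠ 1`, extended to `s = 1`
by its limit there, the Euler–Mascheroni constant `γ` (see `differentiable_zetaRegularPart`). -/
noncomputable def zetaRegularPart : ℂ → ℂ :=
  Function.update (fun s : ℂ => riemannZeta s - 1 / (s - 1)) 1
    (Real.eulerMascheroniConstant : ℂ)

/-- The Stieltjes constants `γ(n)`: the numbers in the Laurent expansion
`ζ(s) = 1/(s-1) + ∑ₙ (-1)ⁿ γ(n) / n! * (s-1)ⁿ` about `s = 1`
(see `hasSum_stieltjesConstant`). -/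
noncomputable def stieltjesConstant (n : ℕ) : ℂ :=
  (-1) ^ n * iteratedDeriv n zetaRegularPart 1

theorem differentiable_zetaRegularPart : Differentiable ℂ zetaRegularPart := by
  have hne : ∀ s : ℂ, s ≠ 1 → DifferentiableAt ℂ zetaRegularPart s := by
    intro s hs
    have h1 : DifferentiableAt ℂ (fun s : ℂ => riemannZeta s - 1 / (s - 1)) s := by
      refine (differentiableAt_riemannZeta hs).sub ?_
      exact (differentiableAt_const _).div (by fun_prop) (sub_ne_zero.mpr hs)
    refine h1.congr_of_eventuallyEq ?_
    filter_upwards [isOpen_ne.mem_nhds hs] with z hz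
    exact Function.update_of_ne hz _ _
  intro s
  by_cases hs : s = 1
  · subst hs
    refine (Complex.analyticAt_of_differentiable_on_punctured_nhds_of_continuousAt
      ?_ ?_).differentiableAt
    · filter_upwards [self_mem_nhdsWithin] with z hz
      exact hne z hz
    · exact continuousAt_update_same.mpr tendsto_riemannZeta_sub_one_div
  · exact hne s hs

/-- The Laurent expansion of `ζ` about `s = 1`. -/
theorem hasSum_stieltjesConstant {s : ℂ} (hs : s ≠ 1) :
    HasSum (fun n : ℕ => (-1) ^ n * stieltjesConstant n / (n.factorial : ℂ) * (s - 1) ^ n)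
      (riemannZeta s - 1 / (s - 1)) := by
  have h := Complex.hasSum_taylorSeries_of_entire differentiable_zetaRegularPart 1 s
  have h2 : zetaRegularPart s = riemannZeta s - 1 / (s - 1) := Function.update_of_ne hs _ _
  rw [h2] at h
  have h3 : (fun n : ℕ => (-1) ^ n * stieltjesConstant n / (n.factorial : ℂ) * (s - 1) ^ n) =
      fun n : ℕ => ((n.factorial : ℂ))⁻¹ • (s - 1) ^ n • iteratedDeriv n zetaRegularPart 1 := by
    funext n
    have hsq : ((-1 : ℂ) ^ n) * (-1) ^ n = 1 := by
      rw [← mul_pow]; simp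
    rw [stieltjesConstant, ← mul_assoc, hsq, one_mul, smul_eq_mul, smul_eq_mul]
    ring
  rw [h3]
  exact h

/-! Put `F z = ζ(1 + z) ζ(1 - z) / sin³(π(1 + z))`. On the line `Re z = -1/2` the sine becomes a
hyperbolic cosine and `F` is the integrand. `F` is odd, so its upward integrals over the two edges
of the strip `|Re z| ≤ 1/2` are opposite. The only pole in the strip is at the origin, and `F`
decays vertically, so the residue theorem makes the integral `-π` times the residue there
(`integral_verticalLine_eq_neg_pi_mul_residue_of_odd`). Decay: each zeta factor is `O(exp(π|Im
z|/2))` by `exists_norm_riemannZeta_le`, which the cubed sine, of size `exp(3π|Im z|)`, outweighs.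
Residue: the pole has order five, and the Taylor polynomials of the sine and of the regular part of
zeta give its coefficient in `exists_zetaMulZetaDivSinCube_laurent`. -/

/-! ### Growth of zeta in vertical strips. -/

/-- For `a ≤ Re s ≤ b`, `|t^(s-1)| ≤ t^(a-1) + t^(b-1)`: the second term dominates for `t ≥ 1`, the
first for `t ≤ 1`. -/
theorem exists_norm_mellin_le {f : ℝ → ℂ} {a b : ℝ} (ha : MellinConvergent f a)
    (hb : MellinConvergent f b) :
    ∃ B : ℝ, ∀ s : ℂ, a ≤ s.re → s.re ≤ b → ‖mellin f s‖ ≤ B := by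
  refine ⟨∫ t in Set.Ioi (0 : ℝ), (‖(t : ℂ) ^ ((a : ℂ) - 1) • f t‖ +
    ‖(t : ℂ) ^ ((b : ℂ) - 1) • f t‖), fun s hsa hsb => ?_⟩
  refine MeasureTheory.norm_integral_le_of_norm_le (ha.norm.add hb.norm) ?_
  filter_upwards [MeasureTheory.ae_restrict_mem measurableSet_Ioi] with t ht
  have ht0 : (0 : ℝ) < t := ht
  simp only [norm_smul, Complex.norm_cpow_eq_rpow_re_of_pos ht0, Complex.sub_re,
    Complex.ofReal_re, Complex.one_re]
  rw [← add_mul]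
  refine mul_le_mul_of_nonneg_right ?_ (norm_nonneg _)
  rcases le_total 1 t with h | h
  · have := Real.rpow_le_rpow_of_exponent_le h (sub_le_sub_right hsb 1)
    have := Real.rpow_nonneg ht0.le (a - 1)
    linarith
  · have := Real.rpow_le_rpow_of_exponent_ge ht0 h (sub_le_sub_right hsa 1)
    have := Real.rpow_nonneg ht0.le (b - 1)
    linarith

theorem exists_norm_completedRiemannZeta₀_le (a b : ℝ) :
    ∃ B : ℝ, ∀ s : ℂ, a ≤ s.re → s.re ≤ b → ‖completedRiemannZeta₀ s‖ ≤ B := by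
  have hconv : ∀ s : ℂ, MellinConvergent (HurwitzZeta.hurwitzEvenFEPair 0).f_modif s := fun s =>
    ((HurwitzZeta.hurwitzEvenFEPair 0).isStrongFEPair_toStrongFEPair.hasMellin s).1
  obtain ⟨B, hB⟩ := exists_norm_mellin_le (hconv ((a / 2 : ℝ) : ℂ)) (hconv ((b / 2 : ℝ) : ℂ))
  refine ⟨B / 2, fun s hsa hsb => ?_⟩
  have h := hB (s / 2) (by simp; linarith) (by simp; linarith)
  -- `completedRiemannZeta₀ s` is by definition half of this Mellin transform at `s / 2`.
  change ‖mellin (HurwitzZeta.hurwitzEvenFEPair 0).f_modif (s / 2) / 2‖ ≤ B / 2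
  rw [norm_div, Complex.norm_two]
  linarith

theorem exists_norm_Gamma_le {a : ℝ} (ha : 0 < a) (b : ℝ) :
    ∃ B : ℝ, ∀ s : ℂ, a ≤ s.re → s.re ≤ b → ‖Complex.Gamma s‖ ≤ B := by
  have hconv : ∀ x : ℝ, 0 < x → MellinConvergent (fun t : ℝ => (Real.exp (-t) : ℂ)) x := by
    intro x hx
    have h := Complex.GammaIntegral_convergent (s := (x : ℂ)) (by simpa using hx)
    refine h.congr_fun (fun t _ => ?_) measurableSet_Ioi
    simp [mul_comm]
  -- `max a b` keeps the right exponent positive, since `b` is arbitrary.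
  obtain ⟨B, hB⟩ := exists_norm_mellin_le (hconv a ha) (hconv (max a b) (by positivity))
  refine ⟨B, fun s hsa hsb => ?_⟩
  rw [Complex.Gamma_eq_integral (by linarith), Complex.GammaIntegral_eq_mellin]
  exact hB s hsa (hsb.trans (le_max_right _ _))

theorem norm_sin_le_exp_abs_im (z : ℂ) : ‖Complex.sin z‖ ≤ Real.exp |z.im| := by
  have h1 : ‖Complex.exp (-z * Complex.I)‖ ≤ Real.exp |z.im| := by
    rw [Complex.norm_exp]
    exact Real.exp_le_exp.mpr (by simpa using le_abs_self z.im)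
  have h2 : ‖Complex.exp (z * Complex.I)‖ ≤ Real.exp |z.im| := by
    rw [Complex.norm_exp]
    exact Real.exp_le_exp.mpr (by simpa using neg_le_abs z.im)
  rw [Complex.sin, norm_div, norm_mul, Complex.norm_I, Complex.norm_two, mul_one]
  have := norm_sub_le (Complex.exp (-z * Complex.I)) (Complex.exp (z * Complex.I))
  linarith

theorem exp_abs_im_le_norm_sin {z : ℂ} (hz : 1 ≤ |z.im|) :
    Real.exp |z.im| / 4 ≤ ‖Complex.sin z‖ := by
  have h1 : ‖Complex.exp (-z * Complex.I)‖ = Real.exp z.im := by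
    rw [Complex.norm_exp]; simp
  have h2 : ‖Complex.exp (z * Complex.I)‖ = Real.exp (-z.im) := by
    rw [Complex.norm_exp]; simp
  have h3 := abs_norm_sub_norm_le (Complex.exp (-z * Complex.I)) (Complex.exp (z * Complex.I))
  rw [h1, h2] at h3
  have h4 : Real.exp |z.im| - Real.exp (-|z.im|) ≤ |Real.exp z.im - Real.exp (-z.im)| := by
    rcases abs_cases z.im with ⟨h, _⟩ | ⟨h, _⟩
    · rw [h]; exact le_abs_self _
    · rw [h, neg_neg, abs_sub_comm]; exact le_abs_self _
  have h5 : Real.exp (-|z.im|) ≤ 1 := Real.exp_le_one_iff.mpr (by linarith)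
  have h6 := Real.add_one_le_exp |z.im|
  rw [Complex.sin, norm_div, norm_mul, Complex.norm_I, Complex.norm_two, mul_one]
  linarith

/-- On the strip `1/2 ≤ Re s ≤ 3/2`, away from the real axis, `ζ` grows at most like
`exp (π |Im s| / 2)`. -/
theorem exists_norm_riemannZeta_le :
    ∃ C : ℝ, ∀ s : ℂ, 1 / 2 ≤ s.re → s.re ≤ 3 / 2 → 1 ≤ |s.im| →
      ‖riemannZeta s‖ ≤ C * Real.exp (Real.pi * |s.im| / 2) := by
  obtain ⟨B, hB⟩ := exists_norm_completedRiemannZeta₀_le (1 / 2) (3 / 2)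
  obtain ⟨G, hG⟩ := exists_norm_Gamma_le (a := 1 / 4) (by norm_num) (3 / 4)
  refine ⟨(B + 2) * (G * Real.pi ^ (3 / 4 : ℝ) / Real.pi), fun s h1 h2 h3 => ?_⟩
  have hs0 : s ≠ 0 := by rintro rfl; norm_num at h1
  -- The two polar terms contribute at most 1 each, as `|Im s| ≥ 1`.
  have hΛ : ‖completedRiemannZeta s‖ ≤ B + 2 := by
    have hn0 : ‖1 / s‖ ≤ 1 := by
      rw [norm_div, norm_one]
      exact div_le_one_of_le₀ (h3.trans (Complex.abs_im_le_norm s)) (norm_nonneg _)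
    have hn1 : ‖1 / (1 - s)‖ ≤ 1 := by
      rw [norm_div, norm_one]
      refine div_le_one_of_le₀ (h3.trans ?_) (norm_nonneg _)
      have := Complex.abs_im_le_norm (1 - s)
      simpa using this
    rw [completedRiemannZeta_eq]
    have ha := norm_sub_le (completedRiemannZeta₀ s - 1 / s) (1 / (1 - s))
    have hb := norm_sub_le (completedRiemannZeta₀ s) (1 / s)
    linarith [hB s h1 h2]
  have hpi : (0 : ℝ) < Real.pi := Real.pi_pos
  have hpic : (Real.pi : ℂ) ≠ 0 := Complex.ofReal_ne_zero.mpr hpi.ne'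
  have hsin : Complex.sin (Real.pi * (s / 2)) ≠ 0 := by
    intro h0
    have him : ((Real.pi : ℂ) * (s / 2)).im = Real.pi * (s.im / 2) := by simp
    have h := exp_abs_im_le_norm_sin (z := Real.pi * (s / 2)) (by
      rw [him, abs_mul, abs_of_pos hpi, abs_div, abs_two]
      nlinarith [Real.pi_gt_three])
    rw [h0, norm_zero] at h
    linarith [Real.exp_pos |((Real.pi : ℂ) * (s / 2)).im|]
  have hrefl := Complex.Gamma_mul_Gamma_one_sub (s / 2)
  have hΓ : Complex.Gamma (s / 2) ≠ 0 := by
    intro h0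
    rw [h0, zero_mul] at hrefl
    exact (div_ne_zero hpic hsin) hrefl.symm
  -- The reflection formula trades a lower bound for `Γ(s/2)` for an upper bound for `Γ(1 - s/2)`,
  -- whose argument has real part in `[1/4, 3/4]`.
  have hinv : 1 / Complex.Gammaℝ s = (Real.pi : ℂ) ^ (s / 2) *
      (Complex.Gamma (1 - s / 2) * Complex.sin (Real.pi * (s / 2)) / Real.pi) := by
    have hG1 : Complex.Gamma (1 - s / 2) * Complex.sin (Real.pi * (s / 2)) / Real.pi =
        1 / Complex.Gamma (s / 2) := by
      rw [eq_div_iff hΓ]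
      rw [eq_div_iff hsin] at hrefl
      rw [div_mul_eq_mul_div, div_eq_one_iff_eq hpic]
      linear_combination hrefl
    rw [hG1, Complex.Gammaℝ_def, neg_div, Complex.cpow_neg]
    field_simp
  have hinv_le : ‖1 / Complex.Gammaℝ s‖ ≤
      G * Real.pi ^ (3 / 4 : ℝ) / Real.pi * Real.exp (Real.pi * |s.im| / 2) := by
    rw [hinv, norm_mul, norm_div, norm_mul, Complex.norm_cpow_eq_rpow_re_of_pos hpi,
      Complex.norm_real, Real.norm_of_nonneg hpi.le]
    have e1 : Real.pi ^ (s / 2).re ≤ Real.pi ^ (3 / 4 : ℝ) :=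
      Real.rpow_le_rpow_of_exponent_le (by linarith [Real.pi_gt_three]) (by simp; linarith)
    have e2 := hG (1 - s / 2) (by simp; linarith) (by simp; linarith)
    have e3 : ‖Complex.sin (Real.pi * (s / 2))‖ ≤ Real.exp (Real.pi * |s.im| / 2) := by
      refine (norm_sin_le_exp_abs_im _).trans_eq ?_
      have him : ((Real.pi : ℂ) * (s / 2)).im = Real.pi * (s.im / 2) := by simp
      rw [him, abs_mul, abs_of_pos hpi, abs_div, abs_two, mul_div_assoc]
    have hG0 : 0 ≤ G := (norm_nonneg _).trans e2
    calc _ ≤ Real.pi ^ (3 / 4 : ℝ) * (G * Real.exp (Real.pi * |s.im| / 2) / Real.pi) := by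
          gcongr
      _ = _ := by ring
  rw [riemannZeta_def_of_ne_zero hs0, div_eq_mul_one_div, norm_mul, mul_assoc]
  exact mul_le_mul hΛ hinv_le (norm_nonneg _) ((norm_nonneg _).trans hΛ)

/-! ### The contour integral over the strip. -/

open Filter Topology in
theorem tendsto_intervalIntegral_inv_pow_verticalLine {n : ℕ} (hn : n ≠ 0) :
    Tendsto (fun T : ℝ => ∫ y : ℝ in (-T)..T, 1 / (-1 / 2 + (y : ℂ) * Complex.I) ^ (n + 1))
      atTop (𝓝 0) := by
  have hne : ∀ y : ℝ, (-1 / 2 + (y : ℂ) * Complex.I) ≠ 0 := by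
    intro y h
    have := congrArg Complex.re h
    norm_num at this
  have hc : Continuous fun y : ℝ => 1 / (-1 / 2 + (y : ℂ) * Complex.I) ^ (n + 1) :=
    continuous_const.div (by fun_prop) fun y => pow_ne_zero _ (hne y)
  have hder : ∀ y : ℝ, HasDerivAt
      (fun y : ℝ => Complex.I / n * ((-1 / 2 + (y : ℂ) * Complex.I) ^ n)⁻¹)
      (1 / (-1 / 2 + (y : ℂ) * Complex.I) ^ (n + 1)) y := by
    intro y
    have h0 : HasDerivAt (fun y : ℝ => -1 / 2 + (y : ℂ) * Complex.I) Complex.I y := by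
      simpa using ((Complex.ofRealCLM.hasDerivAt (x := y)).mul_const Complex.I).const_add (-1 / 2)
    have h1 := ((h0.pow n).inv (pow_ne_zero _ (hne y))).const_mul (Complex.I / n)
    refine h1.congr_deriv ?_
    obtain ⟨m, rfl⟩ := Nat.exists_eq_succ_of_ne_zero hn
    have hm : ((m.succ : ℕ) : ℂ) ≠ 0 := Nat.cast_ne_zero.mpr hn
    have hy := hne y
    simp only [Nat.succ_eq_add_one, Nat.add_sub_cancel, Pi.pow_apply] at hm ⊢
    generalize (-1 / 2 + (y : ℂ) * Complex.I) = w at hy ⊢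
    field_simp
    rw [Complex.I_sq]
    ring
  have hint : ∀ T : ℝ, ∫ y : ℝ in (-T)..T, 1 / (-1 / 2 + (y : ℂ) * Complex.I) ^ (n + 1) =
      Complex.I / n * ((-1 / 2 + (T : ℂ) * Complex.I) ^ n)⁻¹ -
        Complex.I / n * ((-1 / 2 + ((-T : ℝ) : ℂ) * Complex.I) ^ n)⁻¹ := fun T =>
    intervalIntegral.integral_eq_sub_of_hasDerivAt (fun y _ => hder y)
      (hc.intervalIntegrable _ _)
  simp only [hint]
  have hlim : ∀ l : Filter ℝ, Tendsto (fun T : ℝ => |T|) l atTop →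
      Tendsto (fun T : ℝ => Complex.I / n * ((-1 / 2 + (T : ℂ) * Complex.I) ^ n)⁻¹) l (𝓝 0) := by
    intro l hl
    have h1 : Tendsto (fun T : ℝ => ‖(-1 / 2 + (T : ℂ) * Complex.I) ^ n‖) l atTop := by
      simp only [norm_pow]
      refine (tendsto_pow_atTop hn).comp (tendsto_atTop_mono (fun T => ?_) hl)
      simpa using Complex.abs_im_le_norm (-1 / 2 + (T : ℂ) * Complex.I)
    have h2 := tendsto_inv₀_cobounded.comp (tendsto_norm_atTop_iff_cobounded.mp h1)
    simpa using h2.const_mul (Complex.I / n)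
  have hneg : Tendsto (fun T : ℝ => -T) atTop atBot := tendsto_neg_atTop_atBot
  simpa using (hlim atTop tendsto_abs_atTop_atTop).sub
    ((hlim atBot tendsto_abs_atBot_atTop).comp hneg)

-- The line crosses the branch cut of the principal logarithm, so the primitive is written with real
-- `arctan` and `log`; the `log` part is even and cancels.
open Filter Topology in
theorem tendsto_intervalIntegral_inv_verticalLine :
    Tendsto (fun T : ℝ => ∫ y : ℝ in (-T)..T, 1 / (-1 / 2 + (y : ℂ) * Complex.I))
      atTop (𝓝 (-(Real.pi : ℂ))) := by
  have hne : ∀ y : ℝ, (-1 / 2 + (y : ℂ) * Complex.I) ≠ 0 := by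
    intro y h
    have := congrArg Complex.re h
    norm_num at this
  have hc : Continuous fun y : ℝ => 1 / (-1 / 2 + (y : ℂ) * Complex.I) :=
    continuous_const.div (by fun_prop) hne
  have hder : ∀ y : ℝ, HasDerivAt (fun y : ℝ => ((-Real.arctan (2 * y) : ℝ) : ℂ) -
      ((Real.log (1 + 4 * y ^ 2) / 2 : ℝ) : ℂ) * Complex.I)
      (1 / (-1 / 2 + (y : ℂ) * Complex.I)) y := by
    intro y
    have hpos : (0 : ℝ) < 1 + 4 * y ^ 2 := by positivity
    have h1 := (((hasDerivAt_id y).const_mul 2).arctan.neg).ofReal_comp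
    have h2 := (((((hasDerivAt_id y).pow 2).const_mul 4).const_add 1).log
      (by simpa using hpos.ne')).div_const 2 |>.ofReal_comp
    have h3 := h1.sub (h2.mul_const Complex.I)
    refine h3.congr_deriv ?_
    have hp : ((1 : ℂ) + 4 * (y : ℂ) ^ 2) ≠ 0 := by exact_mod_cast hpos.ne'
    have hy := hne y
    simp only [id, mul_one]
    rw [eq_div_iff hy]
    push_cast
    have hsq : (2 * (y : ℂ)) ^ 2 = 4 * (y : ℂ) ^ 2 := by ring
    simp only [id, Pi.pow_apply, Complex.ofReal_pow, hsq]
    field_simp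
    ring_nf
    simp only [Complex.I_sq]
    ring
  have hint : ∀ T : ℝ, ∫ y : ℝ in (-T)..T, 1 / (-1 / 2 + (y : ℂ) * Complex.I) =
      ((-(2 * Real.arctan (2 * T)) : ℝ) : ℂ) := by
    intro T
    rw [intervalIntegral.integral_eq_sub_of_hasDerivAt (fun y _ => hder y)
      (hc.intervalIntegrable _ _)]
    simp only [mul_neg, Real.arctan_neg, neg_sq]
    push_cast
    ring
  simp only [hint]
  have h1 : Tendsto (fun T : ℝ => Real.arctan (2 * T)) atTop (𝓝 (Real.pi / 2)) :=
    (Real.tendsto_arctan_atTop.mono_right nhdsWithin_le_nhds).comp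
      (tendsto_id.const_mul_atTop two_pos)
  have h2 := (Complex.continuous_ofReal.tendsto _).comp (h1.const_mul 2).neg
  have h3 : -(2 * (Real.pi / 2)) = -Real.pi := by ring
  rw [h3, Complex.ofReal_neg] at h2
  exact h2

open Filter Topology in
/-- The residue theorem for the boundary of the strip `|Re z| ≤ 1/2`, for an odd function whose
only pole there is at the origin, of order at most five. -/
theorem integral_verticalLine_eq_neg_pi_mul_residue_of_odd {f h : ℂ → ℂ} {a₁ a₃ a₅ : ℂ}
    (hodd : ∀ z, f (-z) = -f z)
    (hd : ∀ z : ℂ, z ≠ 0 → |z.re| ≤ 1 / 2 → DifferentiableAt ℂ f z)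
    (hh : AnalyticAt ℂ h 0)
    (hf : ∀ᶠ z in 𝓝[≠] 0, f z = a₅ / z ^ 5 + a₃ / z ^ 3 + a₁ / z + h z)
    {η : ℝ → ℝ} (hη : Tendsto η atTop (𝓝 0))
    (hdecay : ∀ z : ℂ, |z.re| ≤ 1 / 2 → 1 ≤ z.im → ‖f z‖ ≤ η z.im)
    (hint : MeasureTheory.Integrable fun y : ℝ => f (-1 / 2 + (y : ℂ) * Complex.I)) :
    ∫ y : ℝ, f (-1 / 2 + (y : ℂ) * Complex.I) = -(Real.pi : ℂ) * a₁ := by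
  set p : ℂ → ℂ := fun z => a₅ / z ^ 5 + a₃ / z ^ 3 + a₁ / z with hp
  -- Without its principal part `f` is holomorphic on the whole strip, so Cauchy's theorem for
  -- rectangles suffices; the principal part is integrated explicitly.
  set H : ℂ → ℂ := Function.update (fun z => f z - p z) 0 (h 0) with hH
  have hHne : ∀ z : ℂ, z ≠ 0 → H z = f z - p z := fun z hz => Function.update_of_ne hz _ _
  have hpodd : ∀ z, p (-z) = -p z := by
    intro z
    have h5 : (-z) ^ 5 = -z ^ 5 := by ring
    have h3 : (-z) ^ 3 = -z ^ 3 := by ring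
    simp only [hp, h5, h3, div_neg]
    ring
  have hHodd : ∀ z : ℂ, z ≠ 0 → H (-z) = -H z := by
    intro z hz
    rw [hHne z hz, hHne (-z) (neg_ne_zero.mpr hz), hodd, hpodd]
    ring
  have hHd : ∀ z : ℂ, |z.re| ≤ 1 / 2 → DifferentiableAt ℂ H z := by
    intro z hz
    by_cases hz0 : z = 0
    · subst hz0
      refine hh.differentiableAt.congr_of_eventuallyEq ?_
      filter_upwards [eventually_nhdsWithin_iff.mp hf] with w hw
      by_cases hw0 : w = 0
      · subst hw0
        exact Function.update_self _ _ _
      · rw [hHne w hw0, hw hw0]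
        simp only [hp]
        ring
    · have hpd : DifferentiableAt ℂ p z := by
        have h5 : z ^ 5 ≠ 0 := pow_ne_zero _ hz0
        have h3 : z ^ 3 ≠ 0 := pow_ne_zero _ hz0
        simp only [hp]
        fun_prop (disch := assumption)
      refine ((hd z hz0 hz).sub hpd).congr_of_eventuallyEq ?_
      filter_upwards [isOpen_ne.mem_nhds hz0] with w hw
      exact hHne w hw
  have hrect : ∀ T : ℝ, 0 < T → ∫ y : ℝ in (-T)..T, H (-1 / 2 + (y : ℂ) * Complex.I) =
      Complex.I * ∫ x : ℝ in (-1 / 2 : ℝ)..(1 / 2), H (x + (T : ℂ) * Complex.I) := by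
    intro T hT
    have hR := Complex.integral_boundary_rect_eq_zero_of_differentiableOn H
      ⟨-1 / 2, -T⟩ ⟨1 / 2, T⟩ (fun z hz => (hHd z (by
        have h1 := (Complex.mem_reProdIm.mp hz).1
        rw [Set.uIcc_of_le (by norm_num)] at h1
        rw [abs_le]
        constructor <;> [have := h1.1; have := h1.2] <;> norm_num at this ⊢ <;>
          linarith)).differentiableWithinAt)
    simp only [smul_eq_mul] at hR
    -- The map `z ↦ -z` exchanges opposite edges, so oddness reduces the four edges to two.
    have hbot : ∫ x : ℝ in (-1 / 2 : ℝ)..(1 / 2), H (x + ((-T : ℝ) : ℂ) * Complex.I) =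
        -∫ x : ℝ in (-1 / 2 : ℝ)..(1 / 2), H (x + (T : ℂ) * Complex.I) := by
      have h1 := intervalIntegral.integral_comp_neg (a := (-1 / 2 : ℝ)) (b := 1 / 2)
        (fun x : ℝ => H (x + ((-T : ℝ) : ℂ) * Complex.I))
      have h2 : -(-1 / 2 : ℝ) = 1 / 2 := by norm_num
      have h3 : -(1 / 2 : ℝ) = -1 / 2 := by norm_num
      rw [h2, h3] at h1
      rw [← h1, ← intervalIntegral.integral_neg]
      refine intervalIntegral.integral_congr fun x _ => ?_
      have hne : (x : ℂ) + (T : ℂ) * Complex.I ≠ 0 := by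
        intro h0
        have := congrArg Complex.im h0
        simp at this
        exact hT.ne' this
      rw [← hHodd _ hne]
      congr 1
      push_cast
      ring
    have hright : ∫ y : ℝ in (-T)..T, H (((1 / 2 : ℝ) : ℂ) + (y : ℂ) * Complex.I) =
        -∫ y : ℝ in (-T)..T, H (-1 / 2 + (y : ℂ) * Complex.I) := by
      have h1 := intervalIntegral.integral_comp_neg (a := -T) (b := T)
        (fun y : ℝ => H (((1 / 2 : ℝ) : ℂ) + (y : ℂ) * Complex.I))
      rw [neg_neg] at h1
      rw [← h1, ← intervalIntegral.integral_neg]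
      refine intervalIntegral.integral_congr fun y _ => ?_
      have hne : -1 / 2 + (y : ℂ) * Complex.I ≠ 0 := by
        intro h0
        have := congrArg Complex.re h0
        norm_num at this
      rw [← hHodd _ hne]
      congr 1
      push_cast
      ring
    have hleft : (((-1 / 2 : ℝ)) : ℂ) = -1 / 2 := by push_cast; ring
    rw [hbot, hright, hleft] at hR
    set A := ∫ y : ℝ in (-T)..T, H (-1 / 2 + (y : ℂ) * Complex.I)
    set B := ∫ x : ℝ in (-1 / 2 : ℝ)..(1 / 2), H (x + (T : ℂ) * Complex.I)
    linear_combination (1 / 2 * Complex.I) * hR + A * Complex.I_sq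
  have hlimH : Tendsto (fun T : ℝ => ∫ y : ℝ in (-T)..T, H (-1 / 2 + (y : ℂ) * Complex.I))
      atTop (𝓝 0) := by
    have hinv : Tendsto (fun T : ℝ => T⁻¹) atTop (𝓝 0) := tendsto_inv_atTop_zero
    have hmaj : Tendsto (fun T : ℝ => η T + (‖a₅‖ * T⁻¹ ^ 5 + ‖a₃‖ * T⁻¹ ^ 3 + ‖a₁‖ * T⁻¹))
        atTop (𝓝 0) := by
      simpa using hη.add ((((hinv.pow 5).const_mul ‖a₅‖).add ((hinv.pow 3).const_mul ‖a₃‖)).add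
        (hinv.const_mul ‖a₁‖))
    refine squeeze_zero_norm' ?_ hmaj
    filter_upwards [eventually_ge_atTop 1] with T hT
    have hT0 : 0 < T := by linarith
    rw [hrect T hT0, norm_mul, Complex.norm_I, one_mul]
    refine (intervalIntegral.norm_integral_le_of_norm_le_const (fun x hx => ?_)).trans_eq
      (?_ : (η T + (‖a₅‖ * T⁻¹ ^ 5 + ‖a₃‖ * T⁻¹ ^ 3 + ‖a₁‖ * T⁻¹)) * |1 / 2 - (-1 / 2 : ℝ)| = _)
    · rw [Set.uIoc_of_le (by norm_num)] at hx
      have him : ((x : ℂ) + (T : ℂ) * Complex.I).im = T := by simp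
      have hre : ((x : ℂ) + (T : ℂ) * Complex.I).re = x := by simp
      have hf1 := hdecay ((x : ℂ) + (T : ℂ) * Complex.I)
        (by rw [hre, abs_le]; constructor <;> linarith [hx.1, hx.2]) (by rw [him]; exact hT)
      rw [him] at hf1
      have hnorm : T ≤ ‖(x : ℂ) + (T : ℂ) * Complex.I‖ := by
        have := Complex.abs_im_le_norm ((x : ℂ) + (T : ℂ) * Complex.I)
        rw [him, abs_of_pos hT0] at this
        exact this
      generalize (x : ℂ) + (T : ℂ) * Complex.I = w at *
      have hw : w ≠ 0 := norm_pos_iff.mp (hT0.trans_le hnorm)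
      have hi : ‖w‖⁻¹ ≤ T⁻¹ := inv_anti₀ hT0 hnorm
      have hpw : ‖p w‖ ≤ ‖a₅‖ * T⁻¹ ^ 5 + ‖a₃‖ * T⁻¹ ^ 3 + ‖a₁‖ * T⁻¹ := by
        refine (norm_add₃_le).trans ?_
        simp only [div_eq_mul_inv, ← inv_pow, norm_mul, norm_pow, norm_inv]
        gcongr
      rw [hHne w hw]
      exact (norm_sub_le _ _).trans (add_le_add hf1 hpw)
    · norm_num
  have hfc : Continuous fun y : ℝ => f (-1 / 2 + (y : ℂ) * Complex.I) := by
    refine continuous_iff_continuousAt.mpr fun y => ?_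
    refine ContinuousAt.comp (g := f) (hd _ ?_ ?_).continuousAt (by fun_prop)
    · intro h0
      have := congrArg Complex.re h0
      norm_num at this
    · norm_num
  have hsplit : ∀ T : ℝ, ∫ y : ℝ in (-T)..T, H (-1 / 2 + (y : ℂ) * Complex.I) =
      (∫ y : ℝ in (-T)..T, f (-1 / 2 + (y : ℂ) * Complex.I)) -
      (a₅ * (∫ y : ℝ in (-T)..T, 1 / (-1 / 2 + (y : ℂ) * Complex.I) ^ (4 + 1)) +
      a₃ * (∫ y : ℝ in (-T)..T, 1 / (-1 / 2 + (y : ℂ) * Complex.I) ^ (2 + 1)) +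
      a₁ * ∫ y : ℝ in (-T)..T, 1 / (-1 / 2 + (y : ℂ) * Complex.I)) := by
    intro T
    have hne : ∀ y : ℝ, -1 / 2 + (y : ℂ) * Complex.I ≠ 0 := by
      intro y h0
      have := congrArg Complex.re h0
      norm_num at this
    have hc : ∀ n : ℕ, Continuous fun y : ℝ => 1 / (-1 / 2 + (y : ℂ) * Complex.I) ^ n := fun n =>
      continuous_const.div (by fun_prop) fun y => pow_ne_zero _ (hne y)
    have hc1 : Continuous fun y : ℝ => 1 / (-1 / 2 + (y : ℂ) * Complex.I) :=
      continuous_const.div (by fun_prop) hne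
    simp only [← intervalIntegral.integral_const_mul]
    have i5 := ((hc (4 + 1)).const_mul a₅).intervalIntegrable (μ := MeasureTheory.volume) (-T) T
    have i3 := ((hc (2 + 1)).const_mul a₃).intervalIntegrable (μ := MeasureTheory.volume) (-T) T
    have i1 := (hc1.const_mul a₁).intervalIntegrable (μ := MeasureTheory.volume) (-T) T
    rw [← intervalIntegral.integral_add i5 i3, ← intervalIntegral.integral_add (i5.add i3) i1,
      ← intervalIntegral.integral_sub (hfc.intervalIntegrable _ _) ((i5.add i3).add i1)]
    refine intervalIntegral.integral_congr fun y _ => ?_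
    rw [hHne _ (hne y)]
    simp only [hp]
    ring
  have hlimf := MeasureTheory.intervalIntegral_tendsto_integral hint tendsto_neg_atTop_atBot
    tendsto_id
  have hlim2 := hlimf.sub ((((tendsto_intervalIntegral_inv_pow_verticalLine
    (four_ne_zero : (4 : ℕ) ≠ 0)).const_mul a₅).add
    ((tendsto_intervalIntegral_inv_pow_verticalLine (two_ne_zero : (2 : ℕ) ≠ 0)).const_mul a₃)).add
    (tendsto_intervalIntegral_inv_verticalLine.const_mul a₁))
  have huniq := tendsto_nhds_unique hlim2 (hlimH.congr hsplit)
  linear_combination huniq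

/-! ### The integrand: parity, holomorphy, decay. -/

/-- The function `ζ(s) ζ(2 - s) / sin³(π s)`, recentred at `s = 1`. -/
noncomputable def zetaMulZetaDivSinCube (z : ℂ) : ℂ :=
  riemannZeta (1 + z) * riemannZeta (1 - z) / Complex.sin (Real.pi * (1 + z)) ^ 3

theorem zetaMulZetaDivSinCube_eq (z : ℂ) : zetaMulZetaDivSinCube z =
    -(riemannZeta (1 + z) * riemannZeta (1 - z)) / Complex.sin (Real.pi * z) ^ 3 := by
  have h : Complex.sin (Real.pi * (1 + z)) = -Complex.sin (Real.pi * z) := by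
    rw [mul_add, mul_one, add_comm, Complex.sin_add_pi]
  rw [zetaMulZetaDivSinCube, h, Odd.neg_pow (by decide), div_neg, neg_div]

theorem zetaMulZetaDivSinCube_neg (z : ℂ) :
    zetaMulZetaDivSinCube (-z) = -zetaMulZetaDivSinCube z := by
  rw [zetaMulZetaDivSinCube_eq, zetaMulZetaDivSinCube_eq, mul_neg, Complex.sin_neg,
    Odd.neg_pow (by decide), sub_neg_eq_add, ← sub_eq_add_neg]
  rw [div_neg, mul_comm]

theorem sin_pi_mul_ne_zero_of_abs_re_le {z : ℂ} (hz : z ≠ 0) (hre : |z.re| ≤ 1 / 2) :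
    Complex.sin (Real.pi * z) ≠ 0 := by
  rw [Complex.sin_ne_zero_iff]
  intro k hk
  have hpi : (Real.pi : ℂ) ≠ 0 := Complex.ofReal_ne_zero.mpr Real.pi_ne_zero
  have hzk : z = k := by
    rw [mul_comm] at hk
    exact mul_right_cancel₀ hpi hk
  rw [hzk, Complex.intCast_re] at hre
  have hk0 : k = 0 := by
    have h1 : |(k : ℝ)| < 1 := by linarith
    exact Int.abs_lt_one_iff.mp (by exact_mod_cast h1)
  exact hz (by rw [hzk, hk0, Int.cast_zero])

theorem differentiableAt_zetaMulZetaDivSinCube {z : ℂ} (hz : z ≠ 0) (hre : |z.re| ≤ 1 / 2) :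
    DifferentiableAt ℂ zetaMulZetaDivSinCube z := by
  have h1 : DifferentiableAt ℂ (fun w : ℂ => riemannZeta (1 + w)) z :=
    (differentiableAt_riemannZeta (by simpa using hz)).comp (f := fun w : ℂ => 1 + w) z
      (by fun_prop)
  have h2 : DifferentiableAt ℂ (fun w : ℂ => riemannZeta (1 - w)) z :=
    (differentiableAt_riemannZeta (by simpa using hz)).comp (f := fun w : ℂ => 1 - w) z
      (by fun_prop)
  have h3 : DifferentiableAt ℂ (fun w : ℂ => Complex.sin (Real.pi * w) ^ 3) z := by fun_prop
  refine ((h1.mul h2).neg.div h3 (pow_ne_zero _ (sin_pi_mul_ne_zero_of_abs_re_le hz hre))).congr_of_eventuallyEq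
    (Filter.Eventually.of_forall fun w => ?_)
  exact zetaMulZetaDivSinCube_eq w

theorem exists_norm_zetaMulZetaDivSinCube_le :
    ∃ M : ℝ, ∀ z : ℂ, |z.re| ≤ 1 / 2 → 1 ≤ |z.im| →
      ‖zetaMulZetaDivSinCube z‖ ≤ M * (1 + z.im ^ 2)⁻¹ := by
  obtain ⟨C, hC⟩ := exists_norm_riemannZeta_le
  refine ⟨64 * C ^ 2, fun z hre him => ?_⟩
  obtain ⟨hre1, hre2⟩ := abs_le.mp hre
  have h1 := hC (1 + z) (by simp; linarith) (by simp; linarith) (by simpa using him)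
  have h2 := hC (1 - z) (by simp; linarith) (by simp; linarith) (by simpa using him)
  have e1 : |(1 + z).im| = |z.im| := by simp
  have e2 : |(1 - z).im| = |z.im| := by simp
  rw [e1] at h1
  rw [e2] at h2
  set t := |z.im| with ht
  have ht2 : z.im ^ 2 = t ^ 2 := (sq_abs _).symm
  set E := Real.exp (Real.pi * t / 2) with hE
  have hE0 : 0 < E := Real.exp_pos _
  have h3 : E ^ 2 / 4 ≤ ‖Complex.sin (Real.pi * z)‖ := by
    have him' : |((Real.pi : ℂ) * z).im| = Real.pi * t := by
      simp [ht, abs_mul, abs_of_pos Real.pi_pos]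
    have h := exp_abs_im_le_norm_sin (z := Real.pi * z) (by
      rw [him']
      nlinarith [Real.pi_gt_three])
    rw [him'] at h
    rwa [hE, ← Real.exp_nat_mul, show ((2 : ℕ) : ℝ) * (Real.pi * t / 2) = Real.pi * t by
      push_cast; ring]
  have hEt : 1 + t ≤ E := by
    have h4 := Real.add_one_le_exp (Real.pi * t / 2)
    have h5 : t ≤ Real.pi * t / 2 := by nlinarith [Real.pi_gt_three]
    linarith
  -- The true decay is `E⁻⁴ = exp(-2πt)`; it is weakened to a standard integrable majorant.
  have hden : 1 + t ^ 2 ≤ E ^ 4 := by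
    have h6 : (1 + t) ^ 2 ≤ E ^ 2 := pow_le_pow_left₀ (by linarith) hEt 2
    have h7 : (1 : ℝ) ≤ E ^ 2 := one_le_pow₀ (by linarith)
    nlinarith
  rw [zetaMulZetaDivSinCube_eq, norm_div, norm_neg, norm_mul, norm_pow, ht2]
  have hCE : 0 ≤ C * E := (norm_nonneg _).trans h1
  calc _ ≤ (C * E) * (C * E) / (E ^ 2 / 4) ^ 3 := by
        gcongr
    _ = 64 * C ^ 2 * (E ^ 4)⁻¹ := by
        field_simp
        ring
    _ ≤ 64 * C ^ 2 * (1 + t ^ 2)⁻¹ := by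
        gcongr

theorem integrable_zetaMulZetaDivSinCube_verticalLine :
    MeasureTheory.Integrable fun y : ℝ =>
      zetaMulZetaDivSinCube (-1 / 2 + (y : ℂ) * Complex.I) := by
  obtain ⟨M, hM⟩ := exists_norm_zetaMulZetaDivSinCube_le
  have hc : Continuous fun y : ℝ => zetaMulZetaDivSinCube (-1 / 2 + (y : ℂ) * Complex.I) := by
    refine continuous_iff_continuousAt.mpr fun y => ?_
    refine ContinuousAt.comp (g := zetaMulZetaDivSinCube)
      (differentiableAt_zetaMulZetaDivSinCube ?_ ?_).continuousAt (by fun_prop)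
    · intro h0
      have := congrArg Complex.re h0
      norm_num at this
    · norm_num
  have hO : ∀ l : Filter ℝ, (∀ᶠ y in l, 1 ≤ |y|) →
      (fun y : ℝ => zetaMulZetaDivSinCube (-1 / 2 + (y : ℂ) * Complex.I)) =O[l]
        fun y : ℝ => (1 + y ^ 2)⁻¹ := by
    intro l hl
    refine Asymptotics.IsBigO.of_bound M ?_
    filter_upwards [hl] with y hy
    have h := hM (-1 / 2 + (y : ℂ) * Complex.I) (by norm_num) (by simpa using hy)
    have him : (-1 / 2 + (y : ℂ) * Complex.I).im = y := by simp
    rwa [him, ← Real.norm_of_nonneg (by positivity : (0 : ℝ) ≤ (1 + y ^ 2)⁻¹)] at h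
  exact hc.locallyIntegrable.integrable_of_isBigO_atBot_atTop
    (hO _ (Filter.tendsto_abs_atBot_atTop.eventually_ge_atTop 1))
    (integrable_inv_one_add_sq.integrableAtFilter _)
    (hO _ (Filter.tendsto_abs_atTop_atTop.eventually_ge_atTop 1))
    (integrable_inv_one_add_sq.integrableAtFilter _)

/-! ### The Laurent expansion at the origin. -/

theorem exists_sin_pi_mul_expansion : ∃ τ : ℂ → ℂ, AnalyticAt ℂ τ 0 ∧ ∀ z : ℂ,
    Complex.sin (Real.pi * z) = Real.pi * z *
      (1 - (Real.pi : ℂ) ^ 2 / 6 * z ^ 2 + (Real.pi : ℂ) ^ 4 / 120 * z ^ 4 + z ^ 5 * τ z) := by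
  have hs : AnalyticAt ℂ Complex.sin 0 := by fun_prop
  -- Order 6 leaves a remainder `z ^ 5` once `π z` is factored out; order 4 does the same for zeta,
  -- whose regular part gets multiplied by `z`.
  obtain ⟨F, hF, hFs⟩ := hs.exists_eq_sum_add_pow_mul 6
  refine ⟨fun z => (Real.pi : ℂ) ^ 5 * F (Real.pi * z), ?_, fun z => ?_⟩
  · have hF' : AnalyticAt ℂ F ((fun z : ℂ => (Real.pi : ℂ) * z) 0) := by simpa using hF
    exact analyticAt_const.mul
      (AnalyticAt.comp (f := fun z : ℂ => (Real.pi : ℂ) * z) hF' (by fun_prop))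
  · rw [hFs (Real.pi * z)]
    simp only [Finset.sum_range_succ, Finset.sum_range_zero, iteratedDeriv_succ',
      iteratedDeriv_zero, Complex.deriv_sin, Complex.deriv_cos', deriv.fun_neg', Nat.factorial,
      Complex.sin_zero, Complex.cos_zero, smul_eq_mul, neg_neg]
    push_cast
    ring

theorem exists_zetaRegularPart_expansion : ∃ ρ : ℂ → ℂ, AnalyticAt ℂ ρ 0 ∧ ∀ z : ℂ,
    zetaRegularPart (1 + z) = (Real.eulerMascheroniConstant : ℂ) - stieltjesConstant 1 * z +
      stieltjesConstant 2 / 2 * z ^ 2 - stieltjesConstant 3 / 6 * z ^ 3 + z ^ 4 * ρ z := by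
  have hr : AnalyticAt ℂ (fun z : ℂ => zetaRegularPart (1 + z)) 0 :=
    (differentiable_zetaRegularPart.comp
      (by fun_prop : Differentiable ℂ fun z : ℂ => 1 + z)).analyticAt 0
  obtain ⟨ρ, hρ, hρs⟩ := hr.exists_eq_sum_add_pow_mul 4
  refine ⟨ρ, hρ, fun z => ?_⟩
  have h0 : zetaRegularPart 1 = (Real.eulerMascheroniConstant : ℂ) := Function.update_self _ _ _
  rw [hρs z]
  simp only [Finset.sum_range_succ, Finset.sum_range_zero, iteratedDeriv_comp_const_add,
    add_zero, stieltjesConstant, iteratedDeriv_zero, h0, Nat.factorial, smul_eq_mul]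
  push_cast
  ring

/-- Division with remainder modulo `z ^ 5` of a product of the shape occurring in the Laurent
expansion of `ζ(1 + z) ζ(1 - z) / sin³(π z)`. -/
theorem exists_sub_mul_cube_eq_pow_five_mul {ρ σ τ : ℂ → ℂ} (hρ : AnalyticAt ℂ ρ 0)
    (hσ : AnalyticAt ℂ σ 0) (hτ : AnalyticAt ℂ τ 0) (g₀ g₁ g₂ g₃ c₂ c₄ : ℂ) :
    ∃ W : ℂ → ℂ, AnalyticAt ℂ W 0 ∧ ∀ z : ℂ,
      (1 + g₀ * z - g₁ * z ^ 2 + g₂ / 2 * z ^ 3 - g₃ / 6 * z ^ 4 + z ^ 5 * ρ z) *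
          (1 - g₀ * z - g₁ * z ^ 2 - g₂ / 2 * z ^ 3 - g₃ / 6 * z ^ 4 - z ^ 5 * σ z) -
        (1 + (3 * c₂ - (2 * g₁ + g₀ ^ 2)) * z ^ 2 +
          (6 * c₂ ^ 2 - 3 * c₄ - 3 * c₂ * (2 * g₁ + g₀ ^ 2) -
            (g₃ / 3 + g₀ * g₂ - g₁ ^ 2)) * z ^ 4) *
          (1 - c₂ * z ^ 2 + c₄ * z ^ 4 + z ^ 5 * τ z) ^ 3 = z ^ 5 * W z := by
  obtain ⟨q₂, hq₂⟩ : ∃ q₂, q₂ = 3 * c₂ - (2 * g₁ + g₀ ^ 2) := ⟨_, rfl⟩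
  obtain ⟨q₄, hq₄⟩ : ∃ q₄, q₄ = 6 * c₂ ^ 2 - 3 * c₄ - 3 * c₂ * (2 * g₁ + g₀ ^ 2) -
    (g₃ / 3 + g₀ * g₂ - g₁ ^ 2) := ⟨_, rfl⟩
  -- The case `τ = 0`: `q₂` and `q₄` are forced by the coefficients of `z ^ 2` and `z ^ 4`.
  have hU : ∀ z : ℂ, (1 + q₂ * z ^ 2 + q₄ * z ^ 4) * (1 - c₂ * z ^ 2 + c₄ * z ^ 4) ^ 3 =
      1 - (2 * g₁ + g₀ ^ 2) * z ^ 2 - (g₃ / 3 + g₀ * g₂ - g₁ ^ 2) * z ^ 4 +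
      z ^ 5 * (z * (q₂ * (3 * c₄ + 3 * c₂ ^ 2) - 3 * q₄ * c₂ +
        q₄ * (3 * c₄ + 3 * c₂ ^ 2) * z ^ 2 +
        (3 * (c₄ ^ 2 * z ^ 2 - 2 * c₂ * c₄) + (c₄ * z ^ 2 - c₂) ^ 3) *
          (1 + q₂ * z ^ 2 + q₄ * z ^ 4))) := by
    intro z
    linear_combination (z ^ 2 - 3 * c₂ * z ^ 4) * hq₂ + z ^ 4 * hq₄
  refine ⟨fun z => z * (g₁ * g₃ / 3 - g₂ ^ 2 / 4 + g₃ ^ 2 / 36 * z ^ 2) +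
    ρ z * (1 - g₀ * z - g₁ * z ^ 2 - g₂ / 2 * z ^ 3 - g₃ / 6 * z ^ 4) -
    σ z * (1 + g₀ * z - g₁ * z ^ 2 + g₂ / 2 * z ^ 3 - g₃ / 6 * z ^ 4) - z ^ 5 * ρ z * σ z -
    z * (q₂ * (3 * c₄ + 3 * c₂ ^ 2) - 3 * q₄ * c₂ + q₄ * (3 * c₄ + 3 * c₂ ^ 2) * z ^ 2 +
      (3 * (c₄ ^ 2 * z ^ 2 - 2 * c₂ * c₄) + (c₄ * z ^ 2 - c₂) ^ 3) *
        (1 + q₂ * z ^ 2 + q₄ * z ^ 4)) -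
    (1 + q₂ * z ^ 2 + q₄ * z ^ 4) * τ z * (3 * (1 - c₂ * z ^ 2 + c₄ * z ^ 4) ^ 2 +
      3 * (1 - c₂ * z ^ 2 + c₄ * z ^ 4) * (z ^ 5 * τ z) + (z ^ 5 * τ z) ^ 2),
    by fun_prop, fun z => ?_⟩
  rw [← hq₂, ← hq₄]
  linear_combination -hU z

-- With `sin(πz) = πz T(z)` and `ζ(1 + z) = A(z) / z`, the function is `A(z) A(-z) / (π³ z⁵ T(z)³)`,
-- so the residue is the `z ^ 4` coefficient of `A(z) A(-z) / T(z)³` over `π³`. The term `17π⁴/120`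
-- is `6c₂² - 3c₄` at `c₂ = π²/6`, `c₄ = π⁴/120`.
open Filter Topology in
theorem exists_zetaMulZetaDivSinCube_laurent :
    ∃ (h : ℂ → ℂ) (a₃ a₅ : ℂ), AnalyticAt ℂ h 0 ∧
      ∀ᶠ z in 𝓝[≠] 0, zetaMulZetaDivSinCube z = a₅ / z ^ 5 + a₃ / z ^ 3 +
        ((17 * (Real.pi : ℂ) ^ 4 / 120 - (Real.pi : ℂ) ^ 2 / 2 *
            (2 * stieltjesConstant 1 + (Real.eulerMascheroniConstant : ℂ) ^ 2) -
          (stieltjesConstant 3 / 3 + (Real.eulerMascheroniConstant : ℂ) * stieltjesConstant 2 -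
            stieltjesConstant 1 ^ 2)) / (Real.pi : ℂ) ^ 3) / z + h z := by
  have hpi : (Real.pi : ℂ) ≠ 0 := Complex.ofReal_ne_zero.mpr Real.pi_ne_zero
  obtain ⟨τ, hτ, hsin⟩ := exists_sin_pi_mul_expansion
  obtain ⟨ρ, hρ, hzeta⟩ := exists_zetaRegularPart_expansion
  have hσ : AnalyticAt ℂ (fun z => ρ (-z)) 0 :=
    AnalyticAt.comp (f := fun z : ℂ => -z) (by simpa using hρ) (by fun_prop)
  obtain ⟨W, hW, hWs⟩ := exists_sub_mul_cube_eq_pow_five_mul hρ hσ hτ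
    (Real.eulerMascheroniConstant : ℂ) (stieltjesConstant 1) (stieltjesConstant 2)
    (stieltjesConstant 3) ((Real.pi : ℂ) ^ 2 / 6) ((Real.pi : ℂ) ^ 4 / 120)
  set T : ℂ → ℂ := fun z => 1 - (Real.pi : ℂ) ^ 2 / 6 * z ^ 2 + (Real.pi : ℂ) ^ 4 / 120 * z ^ 4 +
    z ^ 5 * τ z with hT
  have hTa : AnalyticAt ℂ T 0 := by simp only [hT]; fun_prop
  have hT0 : T 0 ≠ 0 := by simp [hT]
  refine ⟨fun z => W z / ((Real.pi : ℂ) ^ 3 * T z ^ 3),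
    (3 * ((Real.pi : ℂ) ^ 2 / 6) - (2 * stieltjesConstant 1 +
      (Real.eulerMascheroniConstant : ℂ) ^ 2)) / (Real.pi : ℂ) ^ 3, 1 / (Real.pi : ℂ) ^ 3,
    hW.div (analyticAt_const.mul (hTa.pow 3))
      (mul_ne_zero (pow_ne_zero _ hpi) (pow_ne_zero _ hT0)), ?_⟩
  filter_upwards [self_mem_nhdsWithin,
    nhdsWithin_le_nhds (hTa.continuousAt.eventually_ne hT0)] with z hz hTz
  have hz0 : z ≠ 0 := hz
  have hζ : ∀ w : ℂ, w ≠ 0 → riemannZeta (1 + w) = 1 / w + zetaRegularPart (1 + w) := by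
    intro w hw
    have h1 : zetaRegularPart (1 + w) = riemannZeta (1 + w) - 1 / (1 + w - 1) :=
      Function.update_of_ne (by simpa using hw) _ _
    rw [h1, add_sub_cancel_left]
    ring
  have hζm : riemannZeta (1 - z) = 1 / (-z) + zetaRegularPart (1 + -z) := by
    rw [sub_eq_add_neg]
    exact hζ (-z) (neg_ne_zero.mpr hz0)
  have hWz := hWs z
  have hTz' : T z = 1 - (Real.pi : ℂ) ^ 2 / 6 * z ^ 2 + (Real.pi : ℂ) ^ 4 / 120 * z ^ 4 +
    z ^ 5 * τ z := rfl
  rw [zetaMulZetaDivSinCube_eq, hζ z hz0, hζm, hsin, hzeta z, hzeta (-z), ← hTz']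
  rw [← hTz'] at hWz
  generalize T z = t at hWz hTz ⊢
  generalize (Real.pi : ℂ) = p at *
  field_simp
  linear_combination (2 * 120 * 216) * hWz

/-! ### Evaluation of the integral. -/

theorem zetaMulZetaDivSinCube_verticalLine (v : ℝ) :
    zetaMulZetaDivSinCube (-1 / 2 + (v : ℂ) * Complex.I) =
      riemannZeta (3 / 2 - Complex.I * (v : ℂ)) * riemannZeta (1 / 2 + Complex.I * (v : ℂ)) /
        Complex.cosh ((Real.pi : ℂ) * (v : ℂ)) ^ 3 := by
  have h1 : (1 : ℂ) + (-1 / 2 + (v : ℂ) * Complex.I) = 1 / 2 + Complex.I * v := by ring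
  have h2 : (1 : ℂ) - (-1 / 2 + (v : ℂ) * Complex.I) = 3 / 2 - Complex.I * v := by ring
  have h3 : (Real.pi : ℂ) * (1 / 2 + Complex.I * v) =
      (Real.pi : ℂ) * v * Complex.I + Real.pi / 2 := by ring
  rw [zetaMulZetaDivSinCube, h1, h2, h3, Complex.sin_add_pi_div_two, Complex.cos_mul_I,
    mul_comm (riemannZeta _)]

theorem mainTheorem6 :
    MeasureTheory.Integrable (fun v : ℝ =>
      riemannZeta (3 / 2 - Complex.I * (v : ℂ)) * riemannZeta (1 / 2 + Complex.I * (v : ℂ)) /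
        Complex.cosh ((Real.pi : ℂ) * (v : ℂ)) ^ 3) ∧
    ∫ v : ℝ,
      riemannZeta (3 / 2 - Complex.I * (v : ℂ)) * riemannZeta (1 / 2 + Complex.I * (v : ℂ)) /
        Complex.cosh ((Real.pi : ℂ) * (v : ℂ)) ^ 3 =
      -(17 * (Real.pi : ℂ) ^ 2) / 120 + (Real.eulerMascheroniConstant : ℂ) ^ 2 / 2 +
        stieltjesConstant 1 +
        (stieltjesConstant 3 / 3 +
          (Real.eulerMascheroniConstant : ℂ) * stieltjesConstant 2 -
          stieltjesConstant 1 ^ 2) / (Real.pi : ℂ) ^ 2 := by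
  have hint := integrable_zetaMulZetaDivSinCube_verticalLine
  obtain ⟨h, a₃, a₅, hh, hlaurent⟩ := exists_zetaMulZetaDivSinCube_laurent
  obtain ⟨M, hM⟩ := exists_norm_zetaMulZetaDivSinCube_le
  have hη : Filter.Tendsto (fun t : ℝ => M * (1 + t ^ 2)⁻¹) Filter.atTop (nhds 0) := by
    have h1 : Filter.Tendsto (fun t : ℝ => 1 + t ^ 2) Filter.atTop Filter.atTop :=
      Filter.tendsto_atTop_add_const_left _ _ (Filter.tendsto_pow_atTop two_ne_zero)
    simpa using h1.inv_tendsto_atTop.const_mul M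
  have hI := integral_verticalLine_eq_neg_pi_mul_residue_of_odd zetaMulZetaDivSinCube_neg
    (fun z hz hre => differentiableAt_zetaMulZetaDivSinCube hz hre) hh hlaurent hη
    (fun z hre him => hM z hre (him.trans (le_abs_self _))) hint
  simp only [zetaMulZetaDivSinCube_verticalLine] at hint hI
  refine ⟨hint, hI.trans ?_⟩
  have hpi : (Real.pi : ℂ) ≠ 0 := Complex.ofReal_ne_zero.mpr Real.pi_ne_zero
  field_simp
  ring
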